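/- Let $n\ge 1$ and let $(\mathcal C,\Sigma^n,\Theta)$ be an $(n+2)$-angulated category: $\mathcal C$ is an additive category, $\Sigma^n$ is an automorphism (or, more generally, an autoequivalence) of $\mathcal C$, and $\Theta$ is a class of sequences $A_0\xrightarrow{f_0}A_1\xrightarrow{f_1}\cdots\xrightarrow{f_n}A_{n+1}\xrightarrow{f_{n+1}}\Sigma^nA_0$, called $(n+2)$-angles, satisfying the axioms (N1)–(N4) of Geiss, Keller and Oppermann. Assume that idempotents split in $\mathcal C$. For an object $Y$, let $\operatorname{add}Y$ be the class of direct summands of finite direct sums of copies of $Y$. Let $X$ be an Oppermann–Thomas cluster tilting object of $\mathcal C$, that is, $\operatorname{Hom}_{\mathcal C}(X,\Sigma^nX)=0$ and for every object $D$ of $\mathcal C$ there is an $(n+2)$-angle $$X_0\to X_1\to\cdots\to X_n\to D\to\Sigma^nX_0$$ with $X_0,\dots,X_n\in\operatorname{add}X$. Let $\Gamma=\operatorname{End}_{\mathcal C}(X)$, and let $M$ be an indecomposable object of $\mathcal C$ which does not belong to $\operatorname{add}\Sigma^nX$. Let $I_M\subseteq\operatorname{End}_{\mathcal C}(\Sigma^nX)$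 be the factorization ideal of $M$, that is, the ideal of all endomorphisms of $\Sigma^nX$ that factor through an object of $\operatorname{add}M$. Then the right $\Gamma$-module $\operatorname{Hom}_{\mathcal C}(X,M)$ has infinite projective dimension if and only if $I_M\neq 0$. -/

import Mathlib

open CategoryTheory CategoryTheory.Limits

universe v u

attribute [local instance] hasBinaryBiproducts_of_finite_biproducts

noncomputable section

namespace HigherAngulated

variable {C : Type u} [Category.{v} C]

/-- Indices of an `(n+2)`-`Σ`-sequence are taken in `Fin (n + 2)`, with cyclic successor `i + 1`.
`wrap T i` is the identity functor for `i = 0, …, n`, and the suspension functor `T` for the last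
index `i = n + 1`. So `(wrap T i).obj (A (i + 1))` is the object following `A i` in a sequence:
it is `A (i + 1)` when `i ≤ n`, and `T (A 0)` when `i = n + 1`. -/
def wrap {n : ℕ} (T : C ⥤ C) (i : Fin (n + 2)) : C ⥤ C :=
  if i = Fin.last (n + 1) then T else 𝟭 C

theorem wrap_last (n : ℕ) (T : C ⥤ C) : wrap T (Fin.last (n + 1)) = T := if_pos rfl

theorem wrap_of_ne {n : ℕ} (T : C ⥤ C) {i : Fin (n + 2)} (h : i ≠ Fin.last (n + 1)) :
    wrap T i = 𝟭 C := if_neg h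

theorem wrap_zero (n : ℕ) (T : C ⥤ C) : wrap T (0 : Fin (n + 2)) = 𝟭 C :=
  wrap_of_ne T (by simp [Fin.ext_iff])

/-- The identification of `wrap T 0` with the identity functor. -/
def wrapZeroIso (n : ℕ) (T : C ⥤ C) : wrap T (0 : Fin (n + 2)) ≅ 𝟭 C :=
  eqToIso (wrap_zero n T)

/-- An `(n+2)`-`Σ`-sequence `A₀ ⟶ A₁ ⟶ ⋯ ⟶ Aₙ₊₁ ⟶ Σ A₀`, with `Σ = T`. -/
structure SigmaSeq (n : ℕ) (T : C ⥤ C) where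
  /-- the objects `A₀, …, Aₙ₊₁` -/
  obj : Fin (n + 2) → C
  /-- the morphisms `fᵢ : Aᵢ ⟶ Aᵢ₊₁` for `i ≤ n`, and `fₙ₊₁ : Aₙ₊₁ ⟶ Σ A₀` -/
  map : ∀ i : Fin (n + 2), obj i ⟶ (wrap T i).obj (obj (i + 1))

namespace SigmaSeq

variable {n : ℕ} {T : C ⥤ C}

/-- A morphism of `(n+2)`-`Σ`-sequences: `φᵢ : Aᵢ ⟶ Bᵢ` for `i = 0, …, n + 1` such that all squares
commute, the last one being the square with vertical maps `φₙ₊₁` and `Σ φ₀`. -/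
structure Hom (A B : SigmaSeq n T) where
  app : ∀ i : Fin (n + 2), A.obj i ⟶ B.obj i
  comm : ∀ i : Fin (n + 2), A.map i ≫ (wrap T i).map (app (i + 1)) = app i ≫ B.map i

/-- Two sequences are isomorphic if there is a morphism between them all of whose components
are isomorphisms. -/
def Isomorphic (A B : SigmaSeq n T) : Prop :=
  ∃ φ : Hom A B, ∀ i, IsIso (φ.app i)

variable [Preadditive C]

/-- The left rotation
`A₁ ⟶ A₂ ⟶ ⋯ ⟶ Aₙ₊₁ ⟶ Σ A₀ ⟶ Σ A₁` with maps `f₁, …, fₙ₊₁, (-1)ⁿ Σ f₀`. -/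
def leftRotation (A : SigmaSeq n T) : SigmaSeq n T where
  obj i := (wrap T i).obj (A.obj (i + 1))
  map i := (if i = Fin.last (n + 1) then (-1 : ℤ) ^ n else 1) • (wrap T i).map (A.map (i + 1))

variable [HasFiniteBiproducts C]

/-- The direct sum of two sequences. -/
def directSum (A B : SigmaSeq n T) : SigmaSeq n T where
  obj i := A.obj i ⊞ B.obj i
  map i := biprod.desc (A.map i ≫ (wrap T i).map biprod.inl) (B.map i ≫ (wrap T i).map biprod.inr)

/-- The mapping cone of a morphism `φ : A ⟶ B`,
`A₁ ⊞ B₀ ⟶ A₂ ⊞ B₁ ⟶ ⋯ ⟶ Σ A₀ ⊞ Bₙ₊₁ ⟶ Σ (A₁ ⊞ B₀)`,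
whose `i`-th map has matrix entries `-fᵢ₊₁`, `φᵢ₊₁`, `0`, `gᵢ`,
where `fₙ₊₂` is `Σ f₀` and `φₙ₊₂` is `Σ φ₀`. -/
def mappingCone {A B : SigmaSeq n T} (φ : Hom A B) : SigmaSeq n T where
  obj i := (wrap T i).obj (A.obj (i + 1)) ⊞ B.obj i
  map i := biprod.desc
    (-((wrap T i).map (A.map (i + 1)) ≫ (wrap T i).map biprod.inl)
      + (wrap T i).map (φ.app (i + 1)) ≫ (wrap T i).map biprod.inr)
    (B.map i ≫ (wrap T i).map biprod.inr)

end SigmaSeq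

open SigmaSeq

/-- `IsAngulated n T Θ` says that `(C, T, Θ)` is an `(n+2)`-angulated category, where `C` is
additive and `T` is an autoequivalence of `C` (in particular, an automorphism is allowed).
The index `1` is written `0 + 1`, the successor of `0`. -/
structure IsAngulated [Preadditive C] [HasFiniteBiproducts C]
    (n : ℕ) (T : C ⥤ C) (Θ : Set (SigmaSeq n T)) : Prop where
  isEquivalence : T.IsEquivalence
  /-- (N1)(a) closure under isomorphisms -/
  of_isomorphic : ∀ A B : SigmaSeq n T, A.Isomorphic B → A ∈ Θ → B ∈ Θ
  /-- (N1)(a) closure under direct sums -/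
  directSum_mem : ∀ A B : SigmaSeq n T, A ∈ Θ → B ∈ Θ → A.directSum B ∈ Θ
  /-- (N1)(a) closure under direct summands -/
  of_directSum_mem : ∀ A B : SigmaSeq n T, A.directSum B ∈ Θ → A ∈ Θ
  /-- (N1)(b) the trivial sequences `A = A ⟶ 0 ⟶ ⋯ ⟶ 0 ⟶ Σ A`, up to isomorphism -/
  trivial_mem : ∀ A : SigmaSeq n T, IsIso (A.map 0) →
    (∀ i, i ≠ 0 → i ≠ 0 + 1 → IsZero (A.obj i)) → A ∈ Θ
  /-- (N1)(c) every morphism `f` is, up to isomorphism, the first map of an `(n+2)`-angle -/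
  exists_extension : ∀ (X Y : C) (f : X ⟶ Y), ∃ A ∈ Θ, ∃ (e₀ : A.obj 0 ≅ X)
    (e₁ : A.obj (0 + 1) ≅ Y),
    A.map 0 ≫ (wrapZeroIso n T).hom.app (A.obj (0 + 1)) ≫ e₁.hom = e₀.hom ≫ f
  /-- (N2) -/
  leftRotation_mem_iff : ∀ A : SigmaSeq n T, A.leftRotation ∈ Θ ↔ A ∈ Θ
  /-- (N3) -/
  exists_hom : ∀ A ∈ Θ, ∀ B ∈ Θ, ∀ (φ₀ : A.obj 0 ⟶ B.obj 0)
    (φ₁ : A.obj (0 + 1) ⟶ B.obj (0 + 1)),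
    A.map 0 ≫ (wrap T (0 : Fin (n + 2))).map φ₁ = φ₀ ≫ B.map 0 →
    ∃ φ : Hom A B, φ.app 0 = φ₀ ∧ φ.app (0 + 1) = φ₁
  /-- (N4) -/
  exists_hom_mappingCone_mem : ∀ A ∈ Θ, ∀ B ∈ Θ, ∀ (φ₀ : A.obj 0 ⟶ B.obj 0)
    (φ₁ : A.obj (0 + 1) ⟶ B.obj (0 + 1)),
    A.map 0 ≫ (wrap T (0 : Fin (n + 2))).map φ₁ = φ₀ ≫ B.map 0 →
    ∃ φ : Hom A B, φ.app 0 = φ₀ ∧ φ.app (0 + 1) = φ₁ ∧ mappingCone φ ∈ Θ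

variable [Preadditive C] [HasFiniteBiproducts C]

/-- `InAdd X Y`: the object `Y` lies in `add X`, that is, `Y` is a direct summand of a finite direct
sum of copies of `X`. -/
def InAdd (X Y : C) : Prop :=
  ∃ (m : ℕ) (Z : C), Nonempty (Y ⊞ Z ≅ ⨁ fun _ : Fin m => X)

/-- Oppermann–Thomas cluster tilting objects of `(C, T, Θ)`. -/
structure IsClusterTilting {n : ℕ} {T : C ⥤ C} (Θ : Set (SigmaSeq n T)) (X : C) : Prop where
  /-- `Hom(X, Σ X) = 0` -/
  rigid : ∀ f : X ⟶ T.obj X, f = 0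
  /-- every object `D` sits in an `(n+2)`-angle `X₀ ⟶ ⋯ ⟶ Xₙ ⟶ D ⟶ Σ X₀` with `Xᵢ` in `add X` -/
  exists_angle : ∀ D : C, ∃ A ∈ Θ, Nonempty (A.obj (Fin.last (n + 1)) ≅ D) ∧
    ∀ i, i ≠ Fin.last (n + 1) → InAdd X (A.obj i)

theorem factors_iff_sum (M Y : C) (f : Y ⟶ Y) :
    (∃ N : C, InAdd M N ∧ ∃ (a : Y ⟶ N) (b : N ⟶ Y), a ≫ b = f) ↔
    ∃ (m : ℕ) (a : Fin m → (Y ⟶ M)) (b : Fin m → (M ⟶ Y)), f = ∑ i, a i ≫ b i := by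
  constructor
  · rintro ⟨N, ⟨m, Z, ⟨e⟩⟩, a, b, rfl⟩
    refine ⟨m, fun i => a ≫ biprod.inl ≫ e.hom ≫ biproduct.π (fun _ : Fin m => M) i,
      fun i => biproduct.ι (fun _ : Fin m => M) i ≫ e.inv ≫ biprod.fst ≫ b, ?_⟩
    have h : a ≫ b = (a ≫ biprod.inl ≫ e.hom) ≫ 𝟙 (⨁ fun _ : Fin m => M) ≫
        e.inv ≫ biprod.fst ≫ b := by simp
    rw [h, ← biproduct.total]
    simp only [Preadditive.sum_comp, Preadditive.comp_sum, Category.assoc]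
  · rintro ⟨m, a, b, rfl⟩
    have e : (⨁ fun _ : Fin m => M) ⊞ (⨁ fun _ : Fin 0 => M) ≅ ⨁ fun _ : Fin m => M :=
      { hom := biprod.fst
        inv := biprod.inl
        hom_inv_id := by
          apply biprod.hom_ext'
          · simp
          · exact biproduct.hom_ext' _ _ (fun j => j.elim0)
        inv_hom_id := by simp }
    exact ⟨_, ⟨m, _, ⟨e⟩⟩, biproduct.lift a, biproduct.desc b, by simp [biproduct.lift_desc]⟩

/-- The factorization ideal of `M` in `End Y`: all endomorphisms of `Y` that factor through an
object of `add M`. -/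
def factorizationIdeal (Y M : C) : TwoSidedIdeal (End Y) :=
  TwoSidedIdeal.mk'
    {f : End Y | ∃ N : C, InAdd M N ∧ ∃ (a : Y ⟶ N) (b : N ⟶ Y), a ≫ b = f}
    ((factors_iff_sum M Y 0).2 ⟨0, Fin.elim0, Fin.elim0, by simp⟩)
    (by
      intro f g hf hg
      obtain ⟨m, a, b, rfl⟩ := (factors_iff_sum M Y f).1 hf
      obtain ⟨k, c, d, rfl⟩ := (factors_iff_sum M Y g).1 hg
      exact (factors_iff_sum M Y _).2
        ⟨m + k, Fin.append a c, Fin.append b d, by simp [Fin.sum_univ_add]⟩)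
    (by
      rintro f ⟨N, hN, a, b, rfl⟩
      exact ⟨N, hN, -a, b, by simp⟩)
    (by
      rintro g f ⟨N, hN, a, b, rfl⟩
      exact ⟨N, hN, a, b ≫ g, by simp⟩)
    (by
      rintro f g ⟨N, hN, a, b, rfl⟩
      exact ⟨N, hN, g ≫ a, b, by simp⟩)

end HigherAngulated

end

open HigherAngulated

/-! Write Σ for `T` and H for Hom(X, -), a functor to right Γ-modules. Choose an angle X₀ ⟶ ⋯ ⟶ Xₙ ⟶
M ⟶ ΣX₀ with all Xᵢ in add X. Consecutive maps of an angle are weak kernels and weak cokernels of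
each other, and Hom(X, ΣX₀) = 0, so HX₀ ⟶ ⋯ ⟶ HXₙ ⟶ HM ⟶ 0 is exact with projective terms HXᵢ.

The ideal I_M vanishes exactly when HX₀ ⟶ HX₁ is mono (`factorizationIdeal_eq_bot_iff_mono`), and
then HM has a projective resolution of length n.

Conversely, let HM have finite projective dimension. The image K of HX₀ ⟶ HX₁ is an n-th syzygy of
HM, so its projective dimension is finite too. For Z in add X, Ext^i(-, HZ) vanishes on image
modules for i > n (`IsSyzygy.extVanish_add`), so by dimension shifting Ext^i(K, HZ) = 0 for all i >
0. These two facts make K projective (`IsSyzygy.projective_of_extVanish`). Then HX₀ ⟶ K splits, and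
its kernel comes from a summand X' of X₀ with ΣX' a summand of M. As M is indecomposable and not in
add ΣX, X' = 0 and HX₀ ⟶ HX₁ is mono (`mono_of_projective_image`). -/

namespace HigherAngulated

/-! ### Weak kernels and cokernels -/

variable {C : Type u} [Category.{v} C]

instance wrap_isEquivalence {n : ℕ} (T : C ⥤ C) [T.IsEquivalence] (i : Fin (n + 2)) :
    (wrap T i).IsEquivalence := by
  unfold wrap
  split_ifs <;> infer_instance

theorem isIso_of_arrow_iso {X Y X' Y' : C} {f : X ⟶ Y} {g : X' ⟶ Y'}
    (e : Arrow.mk f ≅ Arrow.mk g) [IsIso g] : IsIso f :=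
  (Arrow.isIso_hom_iff_isIso_of_isIso e.hom).2 ‹_›

variable [Preadditive C]

theorem additive_of_isEquivalence [HasFiniteBiproducts C] (G : C ⥤ C) [G.IsEquivalence] :
    G.Additive := by
  have : G.PreservesZeroMorphisms := Functor.preservesZeroMorphisms_of_isLeftAdjoint G
  have : PreservesBinaryBiproducts G :=
    preservesBinaryBiproducts_of_preservesBinaryProducts G
  exact Functor.additive_of_preservesBinaryBiproducts G

/-- `f` is a weak kernel of `g` and `g` is a weak cokernel of `f`. -/
structure WeakExact {X Y Z : C} (f : X ⟶ Y) (g : Y ⟶ Z) : Prop where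
  zero : f ≫ g = 0
  lift : ∀ {W : C} (a : W ⟶ Y), a ≫ g = 0 → ∃ b, b ≫ f = a
  desc : ∀ {W : C} (a : Y ⟶ W), f ≫ a = 0 → ∃ b, g ≫ b = a

namespace WeakExact

variable {X Y Z X' Y' Z' : C} {f : X ⟶ Y} {g : Y ⟶ Z}

theorem of_iso (h : WeakExact f g) {f' : X' ⟶ Y'} {g' : Y' ⟶ Z'} (eX : X ≅ X') (eY : Y ≅ Y')
    (eZ : Z ≅ Z') (hf : f ≫ eY.hom = eX.hom ≫ f') (hg : g ≫ eZ.hom = eY.hom ≫ g') :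
    WeakExact f' g' := by
  obtain rfl : f' = eX.inv ≫ f ≫ eY.hom := by simp [hf]
  obtain rfl : g' = eY.inv ≫ g ≫ eZ.hom := by simp [hg]
  refine ⟨by simp [reassoc_of% h.zero], fun a ha => ?_, fun a ha => ?_⟩
  · obtain ⟨b, hb⟩ := h.lift (a ≫ eY.inv) (by
      rw [← cancel_mono eZ.hom]; simpa using ha)
    exact ⟨b ≫ eX.hom, by simp [reassoc_of% hb]⟩
  · obtain ⟨b, hb⟩ := h.desc (eY.hom ≫ a) (by
      rw [← cancel_epi eX.inv]; simpa using ha)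
    exact ⟨eZ.inv ≫ b, by simp [hb]⟩

theorem map (h : WeakExact f g) (G : C ⥤ C) [G.IsEquivalence] [G.Additive] :
    WeakExact (G.map f) (G.map g) := by
  refine ⟨by rw [← G.map_comp, h.zero, G.map_zero], fun {W} a ha => ?_, fun {W} a ha => ?_⟩
  · obtain ⟨W', ⟨e⟩⟩ := Functor.EssSurj.mem_essImage (F := G) W
    obtain ⟨a', ha'⟩ := G.map_surjective (e.hom ≫ a)
    obtain ⟨b, hb⟩ := h.lift a' (G.map_injective (by rw [G.map_comp, ha']; simp [ha]))
    exact ⟨e.inv ≫ G.map b, by rw [Category.assoc, ← G.map_comp, hb, ha']; simp⟩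
  · obtain ⟨W', ⟨e⟩⟩ := Functor.EssSurj.mem_essImage (F := G) W
    obtain ⟨a', ha'⟩ := G.map_surjective (a ≫ e.inv)
    obtain ⟨b, hb⟩ := h.desc a' (G.map_injective (by rw [G.map_comp, ha', reassoc_of% ha]; simp))
    exact ⟨G.map b ≫ e.hom, by rw [← Category.assoc, ← G.map_comp, hb, ha']; simp⟩

end WeakExact

/-! ### Rotation and the unrolled sequence -/

namespace SigmaSeq

variable {n : ℕ} {T : C ⥤ C}

/-- The sequence obtained by rotating `k` times to the left. -/
def rotate (A : SigmaSeq n T) : ℕ → SigmaSeq n T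
  | 0 => A
  | k + 1 => (rotate A k).leftRotation

theorem rotate_add (A : SigmaSeq n T) (j k : ℕ) : A.rotate (j + k) = (A.rotate j).rotate k := by
  induction k with
  | zero => rfl
  | succ k ih => rw [← add_assoc, rotate, ih, rotate]

/-- The objects `A₀, …, Aₙ₊₁, ΣA₀, ΣA₁, …` of the unrolled sequence. -/
def unrollObj (A : SigmaSeq n T) (k : ℕ) : C := (A.rotate k).obj 0

/-- The morphisms of the unrolled sequence. -/
def unrollMap (A : SigmaSeq n T) (k : ℕ) : A.unrollObj k ⟶ A.unrollObj (k + 1) :=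
  (A.rotate k).map 0

theorem unrollMap_eq (A : SigmaSeq n T) (k : ℕ) :
    Arrow.mk (A.unrollMap k) = Arrow.mk ((A.rotate k).map 0) := rfl

/-- Makes the rotation signs harmless: maps are compared only up to isomorphism of arrows. -/
theorem arrow_smul_iso {X Y : C} (f : X ⟶ Y) (s : ℤ) (hs : s = 1 ∨ s = -1) :
    Nonempty (Arrow.mk (s • f) ≅ Arrow.mk f) := by
  rcases hs with rfl | rfl
  · exact ⟨eqToIso (by simp)⟩
  · exact ⟨Arrow.isoMk (Iso.refl _) ⟨-𝟙 _, -𝟙 _, by simp, by simp⟩ (by simp)⟩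

theorem leftRotation_map_iso (A : SigmaSeq n T) (i : Fin (n + 2)) :
    Nonempty (Arrow.mk (A.leftRotation.map i) ≅
      (wrap T i).mapArrow.obj (Arrow.mk (A.map (i + 1)))) := by
  refine arrow_smul_iso _ _ ?_
  split_ifs
  · exact neg_one_pow_eq_or ℤ n
  · exact Or.inl rfl

theorem leftRotation_map_iso_of_ne (A : SigmaSeq n T) {i : Fin (n + 2)}
    (hi : i ≠ Fin.last (n + 1)) :
    Nonempty (Arrow.mk (A.leftRotation.map i) ≅ Arrow.mk (A.map (i + 1))) := by
  obtain ⟨e⟩ := A.leftRotation_map_iso i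
  -- The source arrow also mentions `wrap T i` in its type; hiding it lets the rewrite typecheck.
  generalize Arrow.mk (A.leftRotation.map i) = x at e ⊢
  rw [wrap_of_ne T hi] at e
  exact ⟨e⟩

theorem leftRotation_map_iso_last (A : SigmaSeq n T) :
    Nonempty (Arrow.mk (A.leftRotation.map (Fin.last (n + 1))) ≅
      Arrow.mk (T.map (A.map 0))) := by
  obtain ⟨e⟩ := A.leftRotation_map_iso (Fin.last (n + 1))
  generalize Arrow.mk (A.leftRotation.map (Fin.last (n + 1))) = x at e ⊢
  rw [wrap_last, Fin.last_add_one] at e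
  exact ⟨e⟩

/-- With `k ≤ n + 2` an index passes the end of the sequence at most once, so at most one `T`
appears. -/
theorem rotate_map_iso (A : SigmaSeq n T) (k : ℕ) (hk : k ≤ n + 2) (i : Fin (n + 2)) :
    (∀ j : Fin (n + 2), i.val + k = j.val →
      Nonempty (Arrow.mk ((A.rotate k).map i) ≅ Arrow.mk (A.map j))) ∧
    (∀ j : Fin (n + 2), i.val + k = j.val + (n + 2) →
      Nonempty (Arrow.mk ((A.rotate k).map i) ≅ Arrow.mk (T.map (A.map j)))) := by
  induction k generalizing i with
  | zero =>
    refine ⟨fun j hj => ?_, fun j hj => ?_⟩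
    · obtain rfl : i = j := Fin.ext (by simpa using hj)
      exact ⟨Iso.refl _⟩
    · omega
  | succ k ih =>
    by_cases hi : i = Fin.last (n + 1)
    · subst hi
      obtain ⟨e⟩ := (A.rotate k).leftRotation_map_iso_last
      refine ⟨fun j hj => ?_, fun j hj => ?_⟩
      · simp at hj; omega
      · obtain ⟨e'⟩ := (ih (by omega) 0).1 j (by simp at hj ⊢; omega)
        exact ⟨e ≪≫ T.mapArrow.mapIso e'⟩
    · obtain ⟨e⟩ := (A.rotate k).leftRotation_map_iso_of_ne hi
      have hv : (i + 1).val = i.val + 1 := by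
        rw [Fin.val_add_one, if_neg hi]
      refine ⟨fun j hj => ?_, fun j hj => ?_⟩
      · obtain ⟨e'⟩ := (ih (by omega) (i + 1)).1 j (by omega)
        exact ⟨e ≪≫ e'⟩
      · obtain ⟨e'⟩ := (ih (by omega) (i + 1)).2 j (by omega)
        exact ⟨e ≪≫ e'⟩

theorem unrollMap_iso (A : SigmaSeq n T) (j : Fin (n + 2)) :
    Nonempty (Arrow.mk (A.unrollMap j) ≅ Arrow.mk (A.map j)) :=
  (A.rotate_map_iso j (by omega) 0).1 j (by simp)

theorem unrollMap_shift_iso (A : SigmaSeq n T) (k : ℕ) (hk : k < n + 2) :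
    Nonempty (Arrow.mk (A.unrollMap (n + 2 + k)) ≅ Arrow.mk (T.map (A.unrollMap k))) := by
  have h : Arrow.mk (A.unrollMap (n + 2 + k)) =
      Arrow.mk ((A.rotate (n + 2)).unrollMap k) := by
    rw [unrollMap_eq, unrollMap_eq, rotate_add]
  obtain ⟨e₁⟩ := (A.rotate (n + 2)).unrollMap_iso ⟨k, hk⟩
  obtain ⟨e₂⟩ := (A.rotate_map_iso (n + 2) le_rfl ⟨k, hk⟩).2 ⟨k, hk⟩ (by simp)
  obtain ⟨e₃⟩ := A.unrollMap_iso ⟨k, hk⟩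
  exact ⟨eqToIso h ≪≫ e₁ ≪≫ e₂ ≪≫ T.mapArrow.mapIso e₃.symm⟩

theorem unrollObj_iso (A : SigmaSeq n T) (j : Fin (n + 2)) :
    Nonempty (A.unrollObj j ≅ A.obj j) := by
  obtain ⟨e⟩ := A.unrollMap_iso j
  exact ⟨Arrow.leftFunc.mapIso e⟩

theorem unrollObj_shift_iso (A : SigmaSeq n T) (k : ℕ) (hk : k < n + 2) :
    Nonempty (A.unrollObj (n + 2 + k) ≅ T.obj (A.unrollObj k)) := by
  obtain ⟨e⟩ := A.unrollMap_shift_iso k hk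
  exact ⟨Arrow.leftFunc.mapIso e⟩

end SigmaSeq

end HigherAngulated

/-! ### Angles are weakly exact -/

namespace HigherAngulated

variable {C : Type u} [Category.{v} C] [Preadditive C]

/-- Removes both the sign and the suspension from the last square of a morphism of rotated
sequences. -/
theorem exists_comp_eq_of_map_smul (G : C ⥤ C) [G.Full] [G.Faithful] [G.Additive] {s : ℤ}
    (hs : s * s = 1) {P Q R S : C} {f : P ⟶ Q} {x : Q ⟶ S} {g : R ⟶ S} {φ : G.obj P ⟶ G.obj R}
    (h : (s • G.map f) ≫ G.map x = φ ≫ (s • G.map g)) : ∃ b, f ≫ x = b ≫ g := by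
  obtain ⟨b, rfl⟩ := G.map_surjective φ
  refine ⟨b, G.map_injective ?_⟩
  have := congrArg (s • ·) h
  simpa [Preadditive.zsmul_comp, Preadditive.comp_zsmul, smul_smul, hs] using this

namespace SigmaSeq

variable {n : ℕ} {T : C ⥤ C}

/-- The sequence `W = W ⟶ Z ⟶ ⋯ ⟶ Z ⟶ ΣW`, with zero maps except for the first one. -/
noncomputable def trivialSeq (n : ℕ) (T : C ⥤ C) (W Z : C) : SigmaSeq n T where
  obj i := if i = 0 ∨ i = 0 + 1 then W else Z
  map i := if h : i = 0 then eqToHom (by subst h; simp [wrap_zero]) else 0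

theorem trivialSeq_isIso (n : ℕ) (T : C ⥤ C) (W Z : C) : IsIso ((trivialSeq n T W Z).map 0) := by
  simp only [trivialSeq, dif_pos]
  infer_instance

theorem trivialSeq_map_of_ne (n : ℕ) (T : C ⥤ C) (W Z : C) {i : Fin (n + 2)} (h : i ≠ 0) :
    (trivialSeq n T W Z).map i = 0 := by
  simp only [trivialSeq, dif_neg h]
  rfl

theorem trivialSeq_obj_zero (n : ℕ) (T : C ⥤ C) (W Z : C) : (trivialSeq n T W Z).obj 0 = W := by
  simp [trivialSeq]

theorem trivialSeq_isZero (n : ℕ) (T : C ⥤ C) (W : C) {Z : C} (hZ : IsZero Z) (i : Fin (n + 2))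
    (h₀ : i ≠ 0) (h₁ : i ≠ 0 + 1) : IsZero ((trivialSeq n T W Z).obj i) := by
  change IsZero (ite _ _ _)
  rwa [if_neg (not_or.2 ⟨h₀, h₁⟩)]

end SigmaSeq

namespace IsAngulated

variable [HasFiniteBiproducts C] {n : ℕ} {T : C ⥤ C} {Θ : Set (SigmaSeq n T)}

theorem trivialSeq_mem (hΘ : IsAngulated n T Θ) (W : C) {Z : C} (hZ : IsZero Z) :
    SigmaSeq.trivialSeq n T W Z ∈ Θ :=
  hΘ.trivial_mem _ (SigmaSeq.trivialSeq_isIso n T W Z)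
    fun i h₀ h₁ => SigmaSeq.trivialSeq_isZero n T W hZ i h₀ h₁

theorem rotate_mem (hΘ : IsAngulated n T Θ) {A : SigmaSeq n T} (hA : A ∈ Θ) (k : ℕ) :
    A.rotate k ∈ Θ := by
  induction k with
  | zero => exact hA
  | succ k ih => exact (hΘ.leftRotation_mem_iff _).2 ih

/-- (N3) extends the pair (1, f₀) to a morphism from the trivial angle on A₀, whose second map is
zero. -/
theorem map_comp_map (hΘ : IsAngulated n T Θ) {A : SigmaSeq n T} (hA : A ∈ Θ) :
    A.map 0 ≫ (wrap T (0 : Fin (n + 2))).map (A.map (0 + 1)) = 0 := by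
  have := hΘ.isEquivalence
  have := additive_of_isEquivalence T
  have : (wrap T (0 : Fin (n + 2))).Additive := additive_of_isEquivalence _
  obtain ⟨Z, hZ⟩ : ∃ Z : C, IsZero Z := ⟨⊤_ C, (IsZero.iff_id_eq_zero _).2 (Subsingleton.elim _ _)⟩
  let B := SigmaSeq.trivialSeq n T (A.obj 0) Z
  have hB0 : B.obj 0 = A.obj 0 := SigmaSeq.trivialSeq_obj_zero n T _ _
  have : IsIso (B.map 0) := SigmaSeq.trivialSeq_isIso n T (A.obj 0) Z
  obtain ⟨φ₁, hφ₁⟩ := (wrap T (0 : Fin (n + 2))).map_surjective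
    (inv (B.map 0) ≫ eqToHom hB0 ≫ A.map 0)
  obtain ⟨φ, -, h₁⟩ := hΘ.exists_hom B (hΘ.trivialSeq_mem _ hZ) A hA (eqToHom hB0) φ₁
    (by rw [hφ₁]; simp)
  have hc := φ.comm (0 + 1)
  have hz : B.map (0 + 1) = 0 := SigmaSeq.trivialSeq_map_of_ne n T _ Z
    (by rw [zero_add]; exact one_ne_zero)
  rw [hz, zero_comp, h₁] at hc
  have := congrArg (wrap T (0 : Fin (n + 2))).map hc
  rw [Functor.map_zero, Functor.map_comp, hφ₁] at this
  simpa using this.symm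

/-- Apply (N3) to (a, 0) between the left rotations of the trivial angle on `W` and of `A`; the last
component is Σ of the lift. -/
theorem exists_lift (hΘ : IsAngulated n T Θ) {A : SigmaSeq n T} (hA : A ∈ Θ)
    {W : C} (a : W ⟶ (wrap T (0 : Fin (n + 2))).obj (A.obj (0 + 1)))
    (ha : a ≫ (wrap T (0 : Fin (n + 2))).map (A.map (0 + 1)) = 0) :
    ∃ b, b ≫ A.map 0 = a := by
  have := hΘ.isEquivalence
  have := additive_of_isEquivalence T
  have : (wrap T (0 : Fin (n + 2))).Additive := additive_of_isEquivalence _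
  obtain ⟨Z, hZ⟩ : ∃ Z : C, IsZero Z := ⟨⊤_ C, (IsZero.iff_id_eq_zero _).2 (Subsingleton.elim _ _)⟩
  let B := SigmaSeq.trivialSeq n T W Z
  have hB0 : B.obj 0 = W := SigmaSeq.trivialSeq_obj_zero n T _ _
  have : IsIso (B.map 0) := SigmaSeq.trivialSeq_isIso n T W Z
  let q : (wrap T (0 : Fin (n + 2))).obj (B.obj (0 + 1)) ⟶
    (wrap T (0 : Fin (n + 2))).obj (A.obj (0 + 1)) := inv (B.map 0) ≫ eqToHom hB0 ≫ a
  have hq : B.map 0 ≫ q = eqToHom hB0 ≫ a := by simp [q]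
  have hqA : q ≫ (wrap T (0 : Fin (n + 2))).map (A.map (0 + 1)) = 0 := by simp [q, ha]
  obtain ⟨φ, h₀, -⟩ := hΘ.exists_hom B.leftRotation (hΘ.rotate_mem (hΘ.trivialSeq_mem _ hZ) 1)
    A.leftRotation (hΘ.rotate_mem hA 1) q 0 (by
      have h : A.leftRotation.map 0 = (wrap T (0 : Fin (n + 2))).map (A.map (0 + 1)) := by
        simp [SigmaSeq.leftRotation]
      rw [h, Functor.map_zero, comp_zero]
      exact hqA.symm)
  obtain ⟨s, hs⟩ : ∃ s : ℤ, s * s = 1 ∧ s = (-1) ^ n :=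
    ⟨(-1) ^ n, by rw [← pow_add, ← two_mul, pow_mul]; simp, rfl⟩
  have key : ∃ b, B.map (Fin.last (n + 1) + 1) ≫ φ.app (Fin.last (n + 1) + 1) =
      b ≫ A.map (Fin.last (n + 1) + 1) := by
    have : (wrap T (Fin.last (n + 1))).Additive := additive_of_isEquivalence _
    have hc := φ.comm (Fin.last (n + 1))
    simp only [SigmaSeq.leftRotation, if_true, ← hs.2] at hc
    exact exists_comp_eq_of_map_smul _ hs.1 hc
  rw [Fin.last_add_one, h₀] at key
  obtain ⟨b, hb⟩ := key
  refine ⟨eqToHom hB0.symm ≫ b, ?_⟩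
  rw [Category.assoc, ← hb]
  exact (congrArg (eqToHom hB0.symm ≫ ·) hq).trans (by simp)

/-- Dual to `exists_lift`: (N3) applied to (0, a), into a rotated trivial angle. -/
theorem exists_desc (hΘ : IsAngulated n T Θ) {A : SigmaSeq n T} (hA : A ∈ Θ)
    {W : C} (a : A.obj (0 + 1) ⟶ W) (ha : A.map 0 ≫ (wrap T (0 : Fin (n + 2))).map a = 0) :
    ∃ b, A.map (0 + 1) ≫ b = a := by
  have := hΘ.isEquivalence
  have := additive_of_isEquivalence T
  have : (wrap T (0 : Fin (n + 2))).Additive := additive_of_isEquivalence _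
  obtain ⟨Z, hZ⟩ : ∃ Z : C, IsZero Z := ⟨⊤_ C, (IsZero.iff_id_eq_zero _).2 (Subsingleton.elim _ _)⟩
  obtain ⟨W', ⟨e⟩⟩ := Functor.EssSurj.mem_essImage (F := T) W
  let D := SigmaSeq.trivialSeq n T W' Z
  have hD : IsIso (D.map 0) := SigmaSeq.trivialSeq_isIso n T W' Z
  let B := D.rotate (n + 1)
  -- After `n + 1` rotations the isomorphism of the trivial angle sits at index 1, with source ΣW' ≅
  -- W.
  obtain ⟨e₁⟩ := (D.rotate_map_iso (n + 1) (by omega) (0 + 1)).2 0 (by simp; omega)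
  have hB1 : IsIso (B.map (0 + 1)) := isIso_of_arrow_iso e₁
  let i₁ : B.obj (0 + 1) ≅ W := Arrow.leftFunc.mapIso e₁ ≪≫
    T.mapIso (eqToIso (SigmaSeq.trivialSeq_obj_zero n T W' Z)) ≪≫ e
  obtain ⟨φ, -, h₁⟩ := hΘ.exists_hom A hA B (hΘ.rotate_mem (hΘ.trivialSeq_mem _ hZ) _) 0
    (a ≫ i₁.inv) (by rw [zero_comp, Functor.map_comp, reassoc_of% ha, zero_comp])
  have hc := φ.comm (0 + 1)
  rw [h₁] at hc
  refine ⟨(wrap T (0 + 1)).map (φ.app (0 + 1 + 1)) ≫ inv (B.map (0 + 1)) ≫ i₁.hom, ?_⟩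
  rw [reassoc_of% hc]
  simp

theorem weakExact (hΘ : IsAngulated n T Θ) {A : SigmaSeq n T} (hA : A ∈ Θ) (k : ℕ) :
    WeakExact (A.unrollMap k) (A.unrollMap (k + 1)) := by
  have := hΘ.isEquivalence
  have := additive_of_isEquivalence T
  have hw : (wrap T (0 : Fin (n + 2))).Additive := additive_of_isEquivalence _
  have hk := hΘ.rotate_mem hA k
  have h : A.unrollMap (k + 1) = (wrap T (0 : Fin (n + 2))).map ((A.rotate k).map (0 + 1)) := by
    simp [SigmaSeq.unrollMap, SigmaSeq.rotate, SigmaSeq.leftRotation]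
    rfl
  refine ⟨?_, ?_, ?_⟩
  · rw [h]; exact hΘ.map_comp_map hk
  · intro W a ha
    rw [h] at ha
    exact hΘ.exists_lift hk a ha
  · intro W (a : (wrap T (0 : Fin (n + 2))).obj ((A.rotate k).obj (0 + 1)) ⟶ W) ha
    obtain ⟨W', ⟨e⟩⟩ := Functor.EssSurj.mem_essImage (F := wrap T (0 : Fin (n + 2))) W
    obtain ⟨a', ha'⟩ : ∃ a' : (A.rotate k).obj (0 + 1) ⟶ W',
        (wrap T (0 : Fin (n + 2))).map a' = a ≫ e.inv := Functor.map_surjective _ _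
    obtain ⟨b, hb⟩ := hΘ.exists_desc hk a' (by
      rw [ha', ← Category.assoc]
      exact (congrArg (· ≫ e.inv) ha).trans zero_comp)
    refine ⟨(wrap T (0 : Fin (n + 2))).map b ≫ e.hom, ?_⟩
    rw [h]
    have := congrArg (wrap T (0 : Fin (n + 2))).map hb
    rw [ha', Functor.map_comp] at this
    exact (Category.assoc _ _ _).symm.trans ((congrArg (· ≫ e.hom) this).trans (by simp))

/-- Every morphism can be continued to the left by weak kernels. -/
theorem exists_weakExact (hΘ : IsAngulated n T Θ) {Z E : C} (h : Z ⟶ E) :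
    ∃ (U V : C) (f : U ⟶ V) (g : V ⟶ Z), WeakExact f g ∧ WeakExact g h := by
  have := hΘ.isEquivalence
  have := additive_of_isEquivalence T
  have := additive_of_isEquivalence T.inv
  obtain ⟨A, hA, e₀, e₁, he⟩ := hΘ.exists_extension Z E h
  have i₀ : Arrow.mk (A.unrollMap 0) ≅ Arrow.mk h :=
    Arrow.isoMk e₀ ((wrapZeroIso n T).app _ ≪≫ e₁) (by simpa [SigmaSeq.unrollMap] using! he.symm)
  obtain ⟨e⟩ := A.unrollMap_shift_iso 0 (by omega)
  have i : T.inv.mapArrow.obj (Arrow.mk (A.unrollMap (n + 2))) ≅ Arrow.mk h :=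
    T.inv.mapArrow.mapIso (e ≪≫ T.mapArrow.mapIso i₀) ≪≫
      (Arrow.isoMk (T.asEquivalence.unitIso.symm.app Z) (T.asEquivalence.unitIso.symm.app E)
        (T.asEquivalence.unitIso.inv.naturality h).symm)
  let j₀ := Arrow.leftFunc.mapIso i
  let j₁ := Arrow.rightFunc.mapIso i
  -- Map `n + 2` of the unrolled sequence is Σh up to isomorphism; desuspending it and the two maps
  -- before it gives the continuation.
  have w₁ := (hΘ.weakExact hA n).map T.inv
  have w₂ := (hΘ.weakExact hA (n + 1)).map T.inv
  refine ⟨_, _, T.inv.map (A.unrollMap n), T.inv.map (A.unrollMap (n + 1)) ≫ j₀.hom,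
    w₁.of_iso (Iso.refl _) (Iso.refl _) j₀ (by simp) (by simp),
    w₂.of_iso (Iso.refl _) j₀ j₁ (by simp) (Arrow.w i.hom).symm⟩

end IsAngulated

end HigherAngulated

/-! ### The functor Hom(X, -) and add X -/

namespace HigherAngulated

variable {C : Type u} [Category.{v} C] [Preadditive C]

section Coyoneda

variable {X : C}

theorem coyonedaObj_map_apply {Y Z : C} (f : Y ⟶ Z) (x : X ⟶ Y) :
    ((preadditiveCoyonedaObj X).map f).hom x = x ≫ f := rfl

theorem coyonedaObj_hom_ext {Y : C} {N : ModuleCat.{v} (End X)ᵐᵒᵖ}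
    {φ ψ : (preadditiveCoyonedaObj X).obj Y ⟶ N} (h : ∀ x : X ⟶ Y, φ.hom x = ψ.hom x) : φ = ψ :=
  ModuleCat.hom_ext (LinearMap.ext h)

theorem coyonedaObj_hom_comp {Y : C} {N : ModuleCat.{v} (End X)ᵐᵒᵖ}
    (φ : (preadditiveCoyonedaObj X).obj Y ⟶ N) (r : X ⟶ X) (x : X ⟶ Y) :
    φ.hom (r ≫ x : X ⟶ Y) = (@MulOpposite.op (End X) r) • φ.hom x :=
  φ.hom.map_smul (@MulOpposite.op (End X) r) x

theorem coyonedaObj_hom_sum {Y : C} {N : ModuleCat.{v} (End X)ᵐᵒᵖ}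
    (φ : (preadditiveCoyonedaObj X).obj Y ⟶ N) {ι : Type*} (s : Finset ι) (x : ι → (X ⟶ Y)) :
    φ.hom (∑ i ∈ s, x i : X ⟶ Y) = ∑ i ∈ s, φ.hom (x i) :=
  map_sum φ.hom x s

theorem coyonedaObj_map_eq_zero_iff {Y Z : C} (f : Y ⟶ Z) :
    (preadditiveCoyonedaObj X).map f = 0 ↔ ∀ x : X ⟶ Y, x ≫ f = 0 :=
  ⟨fun h x => by rw [← coyonedaObj_map_apply, h]; rfl, fun h => coyonedaObj_hom_ext h⟩

theorem WeakExact.coyonedaObj_exact {U V W : C} {f : U ⟶ V} {g : V ⟶ W} (h : WeakExact f g) :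
    (ShortComplex.mk ((preadditiveCoyonedaObj X).map f) ((preadditiveCoyonedaObj X).map g)
      (by rw [← Functor.map_comp, h.zero, Functor.map_zero])).Exact := by
  rw [ShortComplex.moduleCat_exact_iff]
  exact fun x hx => h.lift (W := X) x hx

end Coyoneda

section Add

variable [HasFiniteBiproducts C] {X Y : C}

/-- This dual-basis form of membership in add X is the one used below; `inAdd_of_sum` is the
converse, by splitting idempotents. -/
theorem InAdd.exists_sum (h : InAdd X Y) :
    ∃ (m : ℕ) (a : Fin m → (Y ⟶ X)) (b : Fin m → (X ⟶ Y)), ∑ i, a i ≫ b i = 𝟙 Y := by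
  obtain ⟨m, a, b, hab⟩ := (factors_iff_sum X Y (𝟙 Y)).1 ⟨Y, h, 𝟙 Y, 𝟙 Y, by simp⟩
  exact ⟨m, a, b, hab.symm⟩

theorem exists_biprod_iso_of_retract [IsIdempotentComplete C] {Y W : C} (i : Y ⟶ W) (r : W ⟶ Y)
    (h : i ≫ r = 𝟙 Y) :
    ∃ (Z : C) (e : Y ⊞ Z ≅ W), biprod.inl ≫ e.hom = i ∧ e.inv ≫ biprod.fst = r := by
  have hp : (r ≫ i) ≫ r ≫ i = r ≫ i := by simp [reassoc_of% h]
  obtain ⟨Z, j, q, hjq, hqj⟩ := IsIdempotentComplete.idempotents_split W (𝟙 W - r ≫ i)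
    (Idempotents.idem_of_id_sub_idem _ hp)
  have hj : j ≫ r = 0 := by
    have : (j ≫ q ≫ j) ≫ r = 0 := by
      rw [hqj]; simp [Preadditive.comp_sub, Preadditive.sub_comp, h]
    simpa [reassoc_of% hjq] using this
  have hi : i ≫ q = 0 := by
    have : i ≫ (q ≫ j) ≫ q = 0 := by
      rw [hqj]; simp [Preadditive.comp_sub, Preadditive.sub_comp, reassoc_of% h]
    simpa [hjq] using this
  refine ⟨Z, ⟨biprod.desc i j, biprod.lift r q, ?_, ?_⟩, by simp, by simp⟩
  · ext <;> simp [h, hi, hj, hjq]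
  · rw [biprod.lift_desc, hqj]; simp

theorem inAdd_of_sum [IsIdempotentComplete C] {m : ℕ} (a : Fin m → (Y ⟶ X)) (b : Fin m → (X ⟶ Y))
    (h : ∑ i, a i ≫ b i = 𝟙 Y) : InAdd X Y := by
  obtain ⟨Z, e, -⟩ := exists_biprod_iso_of_retract (biproduct.lift a) (biproduct.desc b)
    (by rw [biproduct.lift_desc, h])
  exact ⟨m, Z, ⟨e⟩⟩

theorem InAdd.of_retract [IsIdempotentComplete C] (h : InAdd X Y) {Z : C} (i : Z ⟶ Y) (r : Y ⟶ Z)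
    (hir : i ≫ r = 𝟙 Z) : InAdd X Z := by
  obtain ⟨m, a, b, hab⟩ := h.exists_sum
  refine inAdd_of_sum (fun k => i ≫ a k) (fun k => b k ≫ r) ?_
  have : i ≫ (∑ k, a k ≫ b k) ≫ r = 𝟙 Z := by rw [hab, Category.id_comp, hir]
  simpa [Preadditive.comp_sum, Preadditive.sum_comp] using this

theorem InAdd.of_iso [IsIdempotentComplete C] (h : InAdd X Y) {Z : C} (e : Y ≅ Z) : InAdd X Z :=
  h.of_retract e.inv e.hom e.inv_hom_id

theorem InAdd.map [IsIdempotentComplete C] (h : InAdd X Y) (G : C ⥤ C) [G.Additive] :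
    InAdd (G.obj X) (G.obj Y) := by
  obtain ⟨m, a, b, hab⟩ := h.exists_sum
  refine inAdd_of_sum (fun k => G.map (a k)) (fun k => G.map (b k)) ?_
  rw [← G.map_id, ← hab]
  simp

theorem InAdd.refl (X : C) : InAdd X X :=
  ⟨1, ⨁ fun _ : Fin 0 => X, ⟨{
    hom := biprod.desc (biproduct.ι (fun _ : Fin 1 => X) 0) 0
    inv := biprod.lift (biproduct.π (fun _ : Fin 1 => X) 0) 0
    hom_inv_id := by
      apply biprod.hom_ext'
      · ext <;> simp
      · exact biproduct.hom_ext' _ _ fun j => j.elim0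
    inv_hom_id := by
      apply biproduct.hom_ext'
      intro j
      rw [Subsingleton.elim j 0]
      simp }⟩⟩

/-- Morphisms out of `add X` are detected by morphisms out of `X`. -/
theorem InAdd.eq_zero_of_source (h : InAdd X Y) {E : C} (f : Y ⟶ E)
    (hf : ∀ x : X ⟶ Y, x ≫ f = 0) : f = 0 := by
  obtain ⟨m, a, b, hab⟩ := h.exists_sum
  rw [← Category.id_comp f, ← hab, Preadditive.sum_comp]
  exact Finset.sum_eq_zero fun i _ => by rw [Category.assoc, hf, comp_zero]

theorem InAdd.eq_zero_of_target (h : InAdd X Y) {E : C} (f : E ⟶ Y)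
    (hf : ∀ x : Y ⟶ X, f ≫ x = 0) : f = 0 := by
  obtain ⟨m, a, b, hab⟩ := h.exists_sum
  rw [← Category.comp_id f, ← hab, Preadditive.comp_sum]
  exact Finset.sum_eq_zero fun i _ => by rw [← Category.assoc, hf, zero_comp]

theorem InAdd.coyonedaObj_map_surjective (h : InAdd X Y) {E : C}
    (φ : (preadditiveCoyonedaObj X).obj Y ⟶ (preadditiveCoyonedaObj X).obj E) :
    ∃ g : Y ⟶ E, (preadditiveCoyonedaObj X).map g = φ := by
  obtain ⟨m, a, b, hab⟩ := h.exists_sum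
  refine ⟨∑ i, a i ≫ (show X ⟶ E from φ.hom (b i)), coyonedaObj_hom_ext fun x => ?_⟩
  rw [coyonedaObj_map_apply]
  conv_rhs => rw [← Category.comp_id x, ← hab, Preadditive.comp_sum, coyonedaObj_hom_sum]
  rw [Preadditive.comp_sum]
  refine Finset.sum_congr rfl fun i _ => ?_
  rw [← Category.assoc, ← Category.assoc, coyonedaObj_hom_comp]
  rfl

theorem InAdd.coyonedaObj_projective (h : InAdd X Y) :
    Projective ((preadditiveCoyonedaObj X).obj Y) := by
  obtain ⟨m, a, b, hab⟩ := h.exists_sum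
  refine ⟨fun {N N'} φ q hq => ?_⟩
  have hs := (ModuleCat.epi_iff_surjective q).1 hq
  choose c hc using fun i => hs (φ.hom (b i))
  refine ⟨ModuleCat.ofHom
    { toFun := fun x : X ⟶ Y => ∑ i, (@MulOpposite.op (End X) (x ≫ a i)) • c i
      map_add' := fun x y => by
        rw [← Finset.sum_add_distrib]
        refine Finset.sum_congr rfl fun i _ => ?_
        rw [← add_smul]
        exact congrArg (· • c i) (congrArg MulOpposite.op (Preadditive.add_comp _ _ _ _ _ _))
      map_smul' := fun r x => by
        rw [Finset.smul_sum]
        refine Finset.sum_congr rfl fun i _ => ?_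
        rw [smul_smul]
        exact congrArg (· • c i) (congrArg MulOpposite.op (Category.assoc _ _ _)) },
    coyonedaObj_hom_ext fun x => ?_⟩
  conv_rhs => rw [← Category.comp_id x, ← hab, Preadditive.comp_sum, coyonedaObj_hom_sum]
  change q.hom (∑ i, @MulOpposite.op (End X) (x ≫ a i) • c i) = _
  rw [map_sum]
  refine Finset.sum_congr rfl fun i _ => ?_
  rw [← Category.assoc, coyonedaObj_hom_comp, ← hc i]
  exact q.hom.map_smul _ _

end Add

end HigherAngulated

/-! ### Ext vanishing and dimension shifting -/

namespace HigherAngulated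

section Homological

universe w v' u'

variable {D : Type u'} [Category.{v'} D] [Abelian D]

theorem shortExact_image {P Q R : D} {f : P ⟶ Q} {g : Q ⟶ R} {w : f ≫ g = 0}
    (h : (ShortComplex.mk f g w).Exact) :
    (ShortComplex.mk (image.ι f) (factorThruImage g) (by
      rw [← cancel_epi (factorThruImage f), ← cancel_mono (image.ι g)]; simp [w])).ShortExact := by
  have w' : image.ι f ≫ g = 0 := by
    rw [← cancel_epi (factorThruImage f)]; simp [w]
  have h' : (ShortComplex.mk (image.ι f) g w').Exact := by
    let τ : ShortComplex.mk f g w ⟶ ShortComplex.mk (image.ι f) g w' :=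
      { τ₁ := factorThruImage f, τ₂ := 𝟙 Q, τ₃ := 𝟙 R }
    have : Epi τ.τ₁ := inferInstanceAs (Epi (factorThruImage f))
    have : IsIso τ.τ₂ := inferInstanceAs (IsIso (𝟙 Q))
    have : Mono τ.τ₃ := inferInstanceAs (Mono (𝟙 R))
    exact (ShortComplex.exact_iff_of_epi_of_isIso_of_mono τ).1 h
  refine { exact := ?_, mono_f := inferInstanceAs (Mono (image.ι f)),
           epi_g := inferInstanceAs (Epi (factorThruImage g)) }
  let τ : ShortComplex.mk (image.ι f) (factorThruImage g) (by
      rw [← cancel_mono (image.ι g)]; simp [w']) ⟶ ShortComplex.mk (image.ι f) g w' :=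
    { τ₁ := 𝟙 _, τ₂ := 𝟙 Q, τ₃ := image.ι g }
  have : Epi τ.τ₁ := inferInstanceAs (Epi (𝟙 (image f)))
  have : IsIso τ.τ₂ := inferInstanceAs (IsIso (𝟙 Q))
  have : Mono τ.τ₃ := inferInstanceAs (Mono (image.ι g))
  exact (ShortComplex.exact_iff_of_epi_of_isIso_of_mono τ).2 h'

open Abelian

variable [HasExt.{w} D]

/-- `Ext^i(A, N) = 0` for all `i > r`. -/
def ExtVanish (A N : D) (r : ℕ) : Prop :=
  ∀ i, r < i → ∀ x : Ext A N i, x = 0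

namespace ExtVanish

variable {A N : D} {r : ℕ}

theorem of_retract (h : ExtVanish A N r) {N' : D} (i : N' ⟶ N) (p : N ⟶ N') (hip : i ≫ p = 𝟙 N') :
    ExtVanish A N' r := by
  intro j hj x
  have := h j hj (x.comp (Ext.mk₀ i) (add_zero j))
  rw [← x.comp_mk₀_id, ← hip, ← Ext.mk₀_comp_mk₀, ← Ext.comp_assoc_of_third_deg_zero, this,
    Ext.zero_comp]

theorem of_iso (h : ExtVanish A N r) {N' : D} (e : N ≅ N') : ExtVanish A N' r :=
  h.of_retract e.inv e.hom e.inv_hom_id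

variable {S : ShortComplex D} (hS : S.ShortExact)
include hS

theorem X₁_of_X₃ (_ : Projective S.X₂) (h : ExtVanish S.X₃ N (r + 1)) : ExtVanish S.X₁ N r := by
  intro i hi x
  obtain ⟨y, rfl⟩ := Ext.contravariant_sequence_exact₁ hS _ x rfl (h _ (by omega) _)
  obtain ⟨j, rfl⟩ : ∃ j, i = j + 1 := ⟨i - 1, by omega⟩
  rw [y.eq_zero_of_projective, Ext.comp_zero]

theorem X₁_of_X₃_target (h₂ : ExtVanish A S.X₂ 0) (h₃ : ExtVanish A S.X₃ r) :
    ExtVanish A S.X₁ (r + 1) := by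
  intro i hi x
  obtain ⟨j, rfl⟩ : ∃ j, i = j + 1 := ⟨i - 1, by omega⟩
  obtain ⟨y, rfl⟩ := Ext.covariant_sequence_exact₁ _ hS x (h₂ _ (by omega) _) rfl
  rw [h₃ j (by omega) y, Ext.zero_comp]

end ExtVanish

variable {S : ShortComplex D} (hS : S.ShortExact)
include hS

/-- As `S.X₂` is projective, Ext¹(S.X₃, N) is the cokernel of restriction along `S.f`. -/
theorem ext_one_eq_zero_of_extension [Projective S.X₂] {N : D}
    (h : ∀ φ : S.X₁ ⟶ N, ∃ ψ, S.f ≫ ψ = φ) (x : Ext S.X₃ N 1) : x = 0 := by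
  obtain ⟨y, rfl⟩ := Ext.contravariant_sequence_exact₃ hS _ x (Ext.eq_zero_of_projective _)
    (add_zero 1)
  obtain ⟨φ, rfl⟩ := Ext.addEquiv₀.symm.surjective y
  obtain ⟨ψ, rfl⟩ := h φ
  change hS.extClass.comp (Ext.mk₀ (S.f ≫ ψ)) _ = 0
  rw [← Ext.mk₀_comp_mk₀, ← Ext.comp_assoc_of_second_deg_zero, hS.extClass_comp, Ext.zero_comp]

/-- Vanishing of Ext¹(S.X₃, S.X₁) extends the identity of `S.X₁` to a retraction of `S.f`. -/
theorem projective_X₃_of_extVanish [Projective S.X₂] (h : ExtVanish S.X₃ S.X₁ 0) :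
    Projective S.X₃ := by
  obtain ⟨y, hy⟩ := Ext.contravariant_sequence_exact₁ hS _ (Ext.mk₀ (𝟙 S.X₁)) (add_zero 1)
    (h 1 (by omega) _)
  obtain ⟨ρ, rfl⟩ := Ext.addEquiv₀.symm.surjective y
  have hρ : S.f ≫ ρ = 𝟙 S.X₁ := by
    apply Ext.addEquiv₀.symm.injective
    change (Ext.mk₀ S.f).comp (Ext.mk₀ ρ) _ = _ at hy
    rwa [Ext.mk₀_comp_mk₀] at hy
  have s := ShortComplex.Splitting.ofExactOfRetraction S hS.exact ρ hρ hS.epi_g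
  exact Retract.projective (⟨s.s, S.g, s.s_g⟩ : Retract S.X₃ S.X₂)

end Homological

end HigherAngulated

/-! ### Image modules and Ext into Hom(X, add X) -/

namespace HigherAngulated

section ClusterTilting

open Abelian

variable {C : Type u} [Category.{v} C] [Preadditive C] [HasFiniteBiproducts C]
  [IsIdempotentComplete C] {n : ℕ} {T : C ⥤ C} {Θ : Set (SigmaSeq n T)} {X : C}

/-- The image modules of `Hom(X, f)` for morphisms `f` of `C`. -/
def IsSyzygy (X : C) (A : ModuleCat.{v} (End X)ᵐᵒᵖ) : Prop :=
  ∃ (E E' : C) (f : E ⟶ E') (p : (preadditiveCoyonedaObj X).obj E ⟶ A)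
    (i : A ⟶ (preadditiveCoyonedaObj X).obj E'),
    Epi p ∧ Mono i ∧ p ≫ i = (preadditiveCoyonedaObj X).map f

omit [HasFiniteBiproducts C] [IsIdempotentComplete C] in
theorem isSyzygy_image {E E' : C} (f : E ⟶ E') :
    IsSyzygy X (image ((preadditiveCoyonedaObj X).map f)) :=
  ⟨E, E', f, factorThruImage _, image.ι _, inferInstance, inferInstance, image.fac _⟩

namespace IsClusterTilting

theorem exists_unroll (hX : IsClusterTilting Θ X) (D : C) :
    ∃ A ∈ Θ, Nonempty (A.unrollObj (n + 1) ≅ D) ∧ ∀ k ≤ n, InAdd X (A.unrollObj k) := by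
  obtain ⟨A, hA, ⟨e⟩, h⟩ := hX.exists_angle D
  refine ⟨A, hA, ?_, fun k hk => ?_⟩
  · obtain ⟨e'⟩ := A.unrollObj_iso (Fin.last (n + 1))
    exact ⟨e' ≪≫ e⟩
  · obtain ⟨e'⟩ := A.unrollObj_iso ⟨k, by omega⟩
    exact (h ⟨k, by omega⟩ (by simp [Fin.ext_iff]; omega)).of_iso e'.symm

theorem hom_eq_zero (hX : IsClusterTilting Θ X) [T.Additive] {Y Y' : C} (hY : InAdd X Y)
    (hY' : InAdd X Y') (f : Y ⟶ T.obj Y') : f = 0 :=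
  hY.eq_zero_of_source f fun _ =>
    (hY'.map T).eq_zero_of_target _ fun _ => hX.rigid _

/-- `U` and `V` are Xₙ₋₁ and Xₙ; `1 ≤ n` ensures that the former exists. -/
theorem exists_approximation (hΘ : IsAngulated n T Θ) (hn : 1 ≤ n) (hX : IsClusterTilting Θ X)
    (E : C) : ∃ (U V Y : C) (f : U ⟶ V) (p : V ⟶ E) (h : E ⟶ T.obj Y),
      InAdd X U ∧ InAdd X V ∧ InAdd X Y ∧ WeakExact f p ∧ WeakExact p h := by
  obtain ⟨A, hA, ⟨e⟩, h⟩ := hX.exists_unroll E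
  obtain ⟨m, rfl⟩ : ∃ m, n = m + 1 := ⟨n - 1, by omega⟩
  obtain ⟨e'⟩ := A.unrollObj_shift_iso 0 (by omega)
  refine ⟨_, _, _, A.unrollMap m, A.unrollMap (m + 1) ≫ e.hom,
    e.inv ≫ A.unrollMap (m + 1 + 1) ≫ e'.hom, h m (by omega), h (m + 1) le_rfl, h 0 (by omega),
    (hΘ.weakExact hA m).of_iso (Iso.refl _) (Iso.refl _) e (by simp) (by simp),
    (hΘ.weakExact hA (m + 1)).of_iso (Iso.refl _) e e' (by simp) (by simp)⟩

theorem coyonedaObj_map_epi (hX : IsClusterTilting Θ X) [T.Additive] {V E Y : C} {p : V ⟶ E}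
    {h : E ⟶ T.obj Y} (hY : InAdd X Y) (w : WeakExact p h) :
    Epi ((preadditiveCoyonedaObj X).map p) := by
  rw [ModuleCat.epi_iff_surjective]
  intro (x : X ⟶ E)
  exact w.lift x (hX.hom_eq_zero (InAdd.refl X) hY _)

/-- Such a map factors through E ⟶ ΣY₀ with Y₀ in add X, and Hom(ΣY₀, Σ²Y) = 0 by rigidity. -/
theorem eq_zero_of_target_shift (hΘ : IsAngulated n T Θ) (hn : 1 ≤ n)
    (hX : IsClusterTilting Θ X) {E Y : C} (hY : InAdd X Y) (a : E ⟶ T.obj (T.obj Y))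
    (ha : ∀ x : X ⟶ E, x ≫ a = 0) : a = 0 := by
  have := hΘ.isEquivalence
  have := additive_of_isEquivalence T
  obtain ⟨U, V, Y₀, f, p, h, -, hV, hY₀, -, w⟩ := exists_approximation hΘ hn hX E
  obtain ⟨c, rfl⟩ := w.desc a (hV.eq_zero_of_source _ fun x => by
    rw [← Category.assoc]; exact ha _)
  obtain ⟨c', rfl⟩ := T.map_surjective c
  rw [hX.hom_eq_zero hY₀ hY c', T.map_zero, comp_zero]

/-- H is full: it is full on maps out of add X, and HU ⟶ HV ⟶ HE ⟶ 0 presents HE. -/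
theorem coyonedaObj_map_surjective (hΘ : IsAngulated n T Θ) (hn : 1 ≤ n)
    (hX : IsClusterTilting Θ X) {E N : C}
    (φ : (preadditiveCoyonedaObj X).obj E ⟶ (preadditiveCoyonedaObj X).obj N) :
    ∃ g : E ⟶ N, (preadditiveCoyonedaObj X).map g = φ := by
  have := hΘ.isEquivalence
  have := additive_of_isEquivalence T
  obtain ⟨U, V, Y₀, f, p, h, hU, hV, hY₀, w₁, w₂⟩ := exists_approximation hΘ hn hX E
  obtain ⟨g₀, hg₀⟩ := hV.coyonedaObj_map_surjective ((preadditiveCoyonedaObj X).map p ≫ φ)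
  obtain ⟨g, hg⟩ := w₁.desc g₀ (hU.eq_zero_of_source _ ((coyonedaObj_map_eq_zero_iff _).1 (by
    rw [Functor.map_comp, hg₀, ← Category.assoc, ← Functor.map_comp, w₁.zero, Functor.map_zero,
      zero_comp])))
  have := coyonedaObj_map_epi hX hY₀ w₂
  refine ⟨g, ?_⟩
  rw [← cancel_epi ((preadditiveCoyonedaObj X).map p), ← Functor.map_comp, hg, hg₀]

end IsClusterTilting

/-- The syzygy of an image module is again one, since weak kernels exist. The extension property
makes H(Σ²Y) behave like an injective on image modules: φ is induced by some u : U ⟶ Σ²Y, which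
vanishes on the weak kernel g₀ of g by `eq_zero_of_target_shift` and so factors through g. -/
theorem IsSyzygy.exists_shortExact (hΘ : IsAngulated n T Θ) (hn : 1 ≤ n)
    (hX : IsClusterTilting Θ X) {A : ModuleCat.{v} (End X)ᵐᵒᵖ} (hA : IsSyzygy X A) :
    ∃ (Z : C) (A' : ModuleCat.{v} (End X)ᵐᵒᵖ) (i : A' ⟶ (preadditiveCoyonedaObj X).obj Z)
      (π : (preadditiveCoyonedaObj X).obj Z ⟶ A) (w : i ≫ π = 0),
      (ShortComplex.mk i π w).ShortExact ∧ InAdd X Z ∧ IsSyzygy X A' ∧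
      ∀ Y, InAdd X Y → ∀ φ : A' ⟶ (preadditiveCoyonedaObj X).obj (T.obj (T.obj Y)),
        ∃ ψ, i ≫ ψ = φ := by
  have := hΘ.isEquivalence
  have := additive_of_isEquivalence T
  obtain ⟨E, E', f, p, j, hp, hj, hpj⟩ := hA
  obtain ⟨_, V, Y₀, _, q, h, -, hV, hY₀, -, w⟩ := hX.exists_approximation hΘ hn E
  have hq := hX.coyonedaObj_map_epi hY₀ w
  let π := (preadditiveCoyonedaObj X).map q ≫ p
  have hπ : Epi π := epi_comp _ _
  have hπj : π ≫ j = (preadditiveCoyonedaObj X).map (q ≫ f) := by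
    rw [Category.assoc, hpj, Functor.map_comp]
  obtain ⟨U₀, U, g₀, g, w₀, w₁⟩ := hΘ.exists_weakExact (q ≫ f)
  have hgπ : (preadditiveCoyonedaObj X).map g ≫ π = 0 := by
    rw [← cancel_mono j, Category.assoc, hπj, ← Functor.map_comp, w₁.zero, Functor.map_zero,
      zero_comp]
  have hex : (ShortComplex.mk _ _ hgπ).Exact := by
    let τ : ShortComplex.mk _ _ hgπ ⟶ ShortComplex.mk ((preadditiveCoyonedaObj X).map g)
        ((preadditiveCoyonedaObj X).map (q ≫ f))
        (by rw [← Functor.map_comp, w₁.zero, Functor.map_zero]) :=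
      { τ₁ := 𝟙 _, τ₂ := 𝟙 _, τ₃ := j
        comm₁₂ := (Category.id_comp _).trans (Category.comp_id _).symm
        comm₂₃ := (Category.id_comp _).trans hπj.symm }
    have : Epi τ.τ₁ := inferInstanceAs (Epi (𝟙 _))
    have : IsIso τ.τ₂ := inferInstanceAs (IsIso (𝟙 _))
    have : Mono τ.τ₃ := hj
    exact (ShortComplex.exact_iff_of_epi_of_isIso_of_mono τ).2 w₁.coyonedaObj_exact
  let pr := kernel.lift π _ hgπ
  have hpr : Epi pr := (ShortComplex.exact_iff_epi_kernel_lift _).1 hex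
  have hprι : pr ≫ kernel.ι π = (preadditiveCoyonedaObj X).map g := kernel.lift_ι _ _ _
  refine ⟨V, kernel π, kernel.ι π, π, kernel.condition π,
    { exact := ShortComplex.exact_kernel π, mono_f := inferInstanceAs (Mono (kernel.ι π)),
      epi_g := hπ }, hV,
    ⟨U, V, g, pr, kernel.ι π, hpr, inferInstance, hprι⟩, fun Y hY φ => ?_⟩
  obtain ⟨u, hu⟩ := hX.coyonedaObj_map_surjective hΘ hn (pr ≫ φ)
  have hg₀ : (preadditiveCoyonedaObj X).map g₀ ≫ pr = 0 := by
    rw [← cancel_mono (kernel.ι π), Category.assoc, hprι, ← Functor.map_comp, w₀.zero,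
      Functor.map_zero, zero_comp]
  obtain ⟨b, hb⟩ := w₀.desc u (hX.eq_zero_of_target_shift hΘ hn hY _
    ((coyonedaObj_map_eq_zero_iff _).1 (by
      rw [Functor.map_comp, hu, ← Category.assoc, hg₀, zero_comp])))
  refine ⟨(preadditiveCoyonedaObj X).map b, ?_⟩
  rw [← cancel_epi pr, ← Category.assoc, hprι, ← Functor.map_comp, hb, hu]

universe w

variable [HasExt.{w} (ModuleCat.{v} (End X)ᵐᵒᵖ)]

theorem IsSyzygy.extVanish_shift (hΘ : IsAngulated n T Θ) (hn : 1 ≤ n)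
    (hX : IsClusterTilting Θ X) {A : ModuleCat.{v} (End X)ᵐᵒᵖ} (hA : IsSyzygy X A) {Y : C}
    (hY : InAdd X Y) :
    ExtVanish A ((preadditiveCoyonedaObj X).obj (T.obj (T.obj Y))) 0 := by
  intro i hi
  obtain ⟨i, rfl⟩ : ∃ j, i = j + 1 := ⟨i - 1, by omega⟩
  clear hi
  induction i generalizing A with
  | zero =>
    intro x
    obtain ⟨Z, A', j, π, w, hS, hZ, -, hl⟩ := hA.exists_shortExact hΘ hn hX
    have : Projective (ShortComplex.mk j π w).X₂ := hZ.coyonedaObj_projective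
    exact ext_one_eq_zero_of_extension hS (hl Y hY) x
  | succ i ih =>
    intro x
    obtain ⟨Z, A', j, π, w, hS, hZ, hA', -⟩ := hA.exists_shortExact hΘ hn hX
    have : Projective (ShortComplex.mk j π w).X₂ := hZ.coyonedaObj_projective
    obtain ⟨y, rfl⟩ := Ext.contravariant_sequence_exact₃ hS _ x (Ext.eq_zero_of_projective _)
      (add_comm 1 (i + 1))
    rw [ih hA' y, Ext.comp_zero]

/-- With Y ≅ ΣD and an angle B₀ ⟶ ⋯ ⟶ Bₙ ⟶ D ⟶ ΣB₀, the sequence 0 ⟶ HY ⟶ H(Σ²B₀) ⟶ ⋯ ⟶ H(Σ²Bₙ) ⟶ 0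
is exact, and its terms after HY have no positive Ext from image modules. -/
theorem IsSyzygy.extVanish_add (hΘ : IsAngulated n T Θ) (hn : 1 ≤ n)
    (hX : IsClusterTilting Θ X) {A : ModuleCat.{v} (End X)ᵐᵒᵖ} (hA : IsSyzygy X A) {Y : C}
    (hY : InAdd X Y) : ExtVanish A ((preadditiveCoyonedaObj X).obj Y) n := by
  have := hΘ.isEquivalence
  have := additive_of_isEquivalence T
  obtain ⟨D, ⟨eD⟩⟩ := Functor.EssSurj.mem_essImage (F := T) Y
  obtain ⟨B, hB, ⟨e⟩, h⟩ := hX.exists_unroll D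
  let N (k : ℕ) := (preadditiveCoyonedaObj X).obj (T.obj (B.unrollObj k))
  let d (k : ℕ) : N k ⟶ N (k + 1) := (preadditiveCoyonedaObj X).map (T.map (B.unrollMap k))
  have hd (k : ℕ) : ∃ w, (ShortComplex.mk (d k) (d (k + 1)) w).Exact :=
    ⟨_, ((hΘ.weakExact hB k).map T).coyonedaObj_exact⟩
  have hN (k : ℕ) (hk : n + 2 ≤ k) (hk' : k ≤ n + 2 + n) : ExtVanish A (N k) 0 := by
    obtain ⟨j, rfl⟩ : ∃ j, k = n + 2 + j := ⟨k - (n + 2), by omega⟩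
    obtain ⟨e'⟩ := B.unrollObj_shift_iso j (by omega)
    exact (hA.extVanish_shift hΘ hn hX (h j (by omega))).of_iso
      ((preadditiveCoyonedaObj X).mapIso (T.mapIso e'.symm))
  have hzero {P : C} (hP : InAdd X P) :
      IsZero ((preadditiveCoyonedaObj X).obj (T.obj P)) := by
    rw [IsZero.iff_id_eq_zero, ← CategoryTheory.Functor.map_id, coyonedaObj_map_eq_zero_iff]
    intro x
    rw [Category.comp_id]
    exact hX.hom_eq_zero (InAdd.refl X) hP x
  -- Left end of the coresolution: `N (n + 1)` is HY up to isomorphism, preceded by H(ΣBₙ) = 0.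
  have hmono : Mono (d (n + 1)) := by
    obtain ⟨w, hw⟩ := hd n
    exact hw.mono_g ((hzero (h n le_rfl)).eq_of_src _ _)
  -- Right end: the next term is H(Σ²D) ≅ H(ΣY) = 0.
  have hepi : Epi (d (n + 1 + n)) := by
    obtain ⟨w, hw⟩ := hd (n + 1 + n)
    obtain ⟨e'⟩ := B.unrollObj_shift_iso (n + 1) (by omega)
    have hz : IsZero (N (n + 2 + (n + 1))) := (hzero hY).of_iso
      ((preadditiveCoyonedaObj X).mapIso (T.mapIso (e' ≪≫ T.mapIso e ≪≫ eD)))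
    rw [show n + 2 + (n + 1) = n + 1 + n + 1 + 1 by omega] at hz
    exact hw.epi_f (hz.eq_of_tgt _ _)
  have key (r j : ℕ) (hj : j + r = n) : ExtVanish A (image (d (n + 1 + j))) r := by
    induction r generalizing j with
    | zero =>
      obtain rfl : j = n := by omega
      have : IsIso (Limits.image.ι (d (j + 1 + j))) := by
        have : Epi (Limits.image.ι (d (j + 1 + j))) :=
          epi_of_epi_fac (image.fac (d (j + 1 + j)))
        exact isIso_of_mono_of_epi _
      exact (hN (j + 1 + j + 1) (by omega) (by omega)).of_iso (asIso (Limits.image.ι (d (j + 1 + j)))).symm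
    | succ r ih =>
      obtain ⟨w, hw⟩ := hd (n + 1 + j)
      exact ExtVanish.X₁_of_X₃_target (shortExact_image hw) (hN _ (by omega) (by omega))
        (ih (j + 1) (by omega))
  have : IsIso (factorThruImage (d (n + 1))) := by
    have : Mono (factorThruImage (d (n + 1))) := mono_of_mono_fac (image.fac (d (n + 1)))
    exact isIso_of_mono_of_epi _
  exact (key n 0 (by omega)).of_iso ((asIso (factorThruImage (d (n + 1)))).symm ≪≫
    (preadditiveCoyonedaObj X).mapIso (T.mapIso e ≪≫ eD))

/-- By induction the syzygy `A'` is projective, hence a retract of some HZ' with Z' in add X; so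
Ext¹(A, A') = 0 and the presentation of `A` splits. -/
theorem IsSyzygy.projective_of_extVanish (hΘ : IsAngulated n T Θ) (hn : 1 ≤ n)
    (hX : IsClusterTilting Θ X) {A : ModuleCat.{v} (End X)ᵐᵒᵖ} (hA : IsSyzygy X A) (k : ℕ)
    (hk : HasProjectiveDimensionLE A k)
    (h : ∀ Z, InAdd X Z → ExtVanish A ((preadditiveCoyonedaObj X).obj Z) 0) :
    Projective A := by
  induction k generalizing A with
  | zero => exact (projective_iff_hasProjectiveDimensionLE_zero A).2 hk
  | succ k ih =>
    obtain ⟨Z, A', j, π, w, hS, hZ, hA', -⟩ := hA.exists_shortExact hΘ hn hX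
    have hP : Projective (ShortComplex.mk j π w).X₂ := hZ.coyonedaObj_projective
    have hpA' : Projective A' := ih hA' ((hS.hasProjectiveDimensionLT_X₃_iff k hP).1 hk)
      fun Z' hZ' => ExtVanish.X₁_of_X₃ hS hP fun i hi => h Z' hZ' i (by omega)
    obtain ⟨Z', A'', _, π', w', hS', hZ', -⟩ := hA'.exists_shortExact hΘ hn hX
    have : Epi π' := hS'.epi_g
    exact projective_X₃_of_extVanish hS
      ((h Z' hZ').of_retract (Projective.factorThru (𝟙 A') π') π' (by simp))

end ClusterTilting

end HigherAngulated

/-! ### The factorization ideal and the resolution of Hom(X, M) -/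

namespace HigherAngulated

variable {C : Type u} [Category.{v} C] [Preadditive C] [HasFiniteBiproducts C]

theorem mem_factorizationIdeal (Y M : C) (f : End Y) :
    f ∈ factorizationIdeal Y M ↔
      ∃ N : C, InAdd M N ∧ ∃ (a : Y ⟶ N) (b : N ⟶ Y), a ≫ b = f :=
  TwoSidedIdeal.mem_mk' _ _ _ _ _ _ _

theorem factorizationIdeal_eq_bot_iff (Y M : C) :
    factorizationIdeal Y M = ⊥ ↔ ∀ (a : Y ⟶ M) (b : M ⟶ Y), a ≫ b = 0 := by
  constructor
  · intro h a b
    have : (show End Y from a ≫ b) ∈ factorizationIdeal Y M :=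
      (mem_factorizationIdeal Y M _).2 ⟨M, InAdd.refl M, a, b, rfl⟩
    rw [h] at this
    exact (TwoSidedIdeal.mem_bot _).1 this
  · intro h
    rw [eq_bot_iff]
    intro f hf
    obtain ⟨m, a, b, hab⟩ := (factors_iff_sum M Y f).1 ((mem_factorizationIdeal Y M f).1 hf)
    refine (TwoSidedIdeal.mem_bot _).2 ?_
    rw [hab]
    exact Finset.sum_eq_zero fun i _ => h _ _

theorem idempotent_eq_zero_or_eq_id [IsIdempotentComplete C] {M : C} (hM : Indecomposable M)
    (p : M ⟶ M) (hp : p ≫ p = p) : p = 0 ∨ p = 𝟙 M := by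
  obtain ⟨Y, i, r, hir, hri⟩ := IsIdempotentComplete.idempotents_split M p hp
  obtain ⟨Z, e, hi, hr⟩ := exists_biprod_iso_of_retract i r hir
  rcases hM.2 Y Z e.symm with hY | hZ
  · exact Or.inl (by rw [← hri, hY.eq_of_tgt r 0, zero_comp])
  · refine Or.inr ?_
    have h : (biprod.fst : Y ⊞ Z ⟶ Y) ≫ biprod.inl = 𝟙 (Y ⊞ Z) := by
      rw [← biprod.total, hZ.eq_of_tgt biprod.snd 0, zero_comp, add_zero]
    rw [← hri, ← hi, ← hr, Category.assoc, reassoc_of% h, e.inv_hom_id]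

omit [HasFiniteBiproducts C] in
theorem SigmaSeq.exists_unrollMap_shift_iso {n : ℕ} {T : C ⥤ C} (A : SigmaSeq n T) :
    ∃ (i₀ : A.unrollObj (n + 2) ≅ T.obj (A.unrollObj 0))
      (i₁ : A.unrollObj (n + 2 + 1) ≅ T.obj (A.unrollObj 1)),
      A.unrollMap (n + 2) ≫ i₁.hom = i₀.hom ≫ T.map (A.unrollMap 0) := by
  obtain ⟨e⟩ := A.unrollMap_shift_iso 0 (by omega)
  exact ⟨Arrow.leftFunc.mapIso e, Arrow.rightFunc.mapIso e, (Arrow.w e.hom).symm⟩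

variable [IsIdempotentComplete C] {n : ℕ} {T : C ⥤ C} {Θ : Set (SigmaSeq n T)} {X : C}

/-- Maps x : X ⟶ X₀ killed by X₀ ⟶ X₁ correspond under Σ to maps ΣX ⟶ ΣX₀ that factor through M ⟶
ΣX₀, while every M ⟶ ΣX factors through M ⟶ ΣX₀ because Hom(Xₙ, ΣX) = 0. -/
theorem factorizationIdeal_eq_bot_iff_mono (hΘ : IsAngulated n T Θ) (hX : IsClusterTilting Θ X)
    {A : SigmaSeq n T} (hA : A ∈ Θ) (hAX : ∀ k ≤ n, InAdd X (A.unrollObj k)) {M : C}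
    (e : A.unrollObj (n + 1) ≅ M) :
    factorizationIdeal (T.obj X) M = ⊥ ↔
      Mono ((preadditiveCoyonedaObj X).map (A.unrollMap 0)) := by
  have := hΘ.isEquivalence
  have := additive_of_isEquivalence T
  obtain ⟨i₀, i₁, hi⟩ := A.exists_unrollMap_shift_iso
  have w₁ := hΘ.weakExact hA n
  have w₂ := hΘ.weakExact hA (n + 1)
  rw [factorizationIdeal_eq_bot_iff, Preadditive.mono_iff_cancel_zero]
  constructor
  · intro h
    suffices hm : ∀ x : X ⟶ A.unrollObj 0, x ≫ A.unrollMap 0 = 0 → x = 0 by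
      intro P g hg
      ext y
      exact hm _ (congrArg (fun φ => φ.hom y) hg)
    intro x hx
    apply T.map_injective
    rw [T.map_zero, ← cancel_mono i₀.inv, zero_comp]
    obtain ⟨a, ha⟩ := w₂.lift (T.map x ≫ i₀.inv) (by
      rw [← cancel_mono i₁.hom, Category.assoc, Category.assoc]
      change T.map x ≫ i₀.inv ≫ A.unrollMap (n + 2) ≫ i₁.hom = 0 ≫ i₁.hom
      rw [hi, Iso.inv_hom_id_assoc, ← T.map_comp, hx, T.map_zero, zero_comp])
    refine (((hAX 0 (by omega)).map T).of_iso i₀.symm).eq_zero_of_target _ fun y => ?_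
    rw [← ha, Category.assoc]
    have := h (a ≫ e.hom) (e.inv ≫ A.unrollMap (n + 1) ≫ y)
    simpa using this
  · intro h a b
    have hm : ∀ x : X ⟶ A.unrollObj 0, x ≫ A.unrollMap 0 = 0 → x = 0 := by
      intro x hx
      have hinj := (ModuleCat.mono_iff_injective ((preadditiveCoyonedaObj X).map
        (A.unrollMap 0))).1 ((Preadditive.mono_iff_cancel_zero _).2 h)
      exact hinj (hx.trans (zero_comp (Z := A.unrollObj 1)).symm)
    obtain ⟨c, hc⟩ := w₁.desc (e.hom ≫ b) (hX.hom_eq_zero (hAX n le_rfl) (InAdd.refl X) _)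
    have hz : (a ≫ e.inv) ≫ A.unrollMap (n + 1) = 0 := by
      obtain ⟨x, hx⟩ := T.map_surjective (((a ≫ e.inv) ≫ A.unrollMap (n + 1)) ≫ i₀.hom)
      rw [← cancel_mono i₀.hom, ← hx, zero_comp, hm x, T.map_zero]
      apply T.map_injective
      rw [T.map_comp, hx, T.map_zero, Category.assoc, ← hi, Category.assoc, reassoc_of% w₂.zero,
        zero_comp, comp_zero]
    have : a ≫ b = ((a ≫ e.inv) ≫ A.unrollMap (n + 1)) ≫ c := by
      rw [Category.assoc, hc]; simp
    rw [this, hz, zero_comp]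

theorem mono_of_projective_image (hΘ : IsAngulated n T Θ) {A : SigmaSeq n T} (hA : A ∈ Θ)
    (hAX : InAdd X (A.unrollObj 0)) {M : C} (e : A.unrollObj (n + 1) ≅ M) (hM : Indecomposable M)
    (hMX : ¬ InAdd (T.obj X) M)
    (hP : Projective (image ((preadditiveCoyonedaObj X).map (A.unrollMap 0)))) :
    Mono ((preadditiveCoyonedaObj X).map (A.unrollMap 0)) := by
  have := hΘ.isEquivalence
  have := additive_of_isEquivalence T
  obtain ⟨i₀, i₁, hi⟩ := A.exists_unrollMap_shift_iso
  obtain ⟨I, π, ι, hI, hπe, hιm, hπ⟩ : ∃ (I : ModuleCat.{v} (End X)ᵐᵒᵖ) (π : _ ⟶ I) (ι : I ⟶ _),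
      Projective I ∧ Epi π ∧ Mono ι ∧ π ≫ ι = (preadditiveCoyonedaObj X).map (A.unrollMap 0) :=
    ⟨_, _, _, hP, inferInstance, inferInstance, image.fac _⟩
  obtain ⟨s, hs⟩ : ∃ s, s ≫ π = 𝟙 _ := ⟨Projective.factorThru (𝟙 _) π, by simp⟩
  -- ε is the idempotent of X₀ that splits off the projective image; η = 1 - ε below cuts out the
  -- kernel.
  obtain ⟨ε, hε⟩ := hAX.coyonedaObj_map_surjective (π ≫ s)
  have hinj {E : C} {f g : A.unrollObj 0 ⟶ E}
      (h : (preadditiveCoyonedaObj X).map f = (preadditiveCoyonedaObj X).map g) : f = g := by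
    rw [← sub_eq_zero]
    refine hAX.eq_zero_of_source _ ((coyonedaObj_map_eq_zero_iff _).1 ?_)
    rw [Functor.map_sub, h, sub_self]
  have hεε : ε ≫ ε = ε := hinj (by
    rw [Functor.map_comp, hε, Category.assoc, reassoc_of% hs])
  have hεm : ε ≫ A.unrollMap 0 = A.unrollMap 0 := hinj (by
    rw [Functor.map_comp, hε, ← hπ, Category.assoc, reassoc_of% hs])
  have hη := Idempotents.idem_of_id_sub_idem ε hεε
  have hηm : (𝟙 _ - ε) ≫ A.unrollMap 0 = 0 := by
    rw [Preadditive.sub_comp, hεm, Category.id_comp, sub_self]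
  generalize hη' : 𝟙 _ - ε = η at hη hηm
  let θ := i₀.hom ≫ T.map η ≫ i₀.inv
  have hθ : θ ≫ θ = θ := by
    simp only [θ, Category.assoc, Iso.inv_hom_id_assoc]
    rw [← T.map_comp_assoc, hη]
  -- η is killed by X₀ ⟶ X₁, so its suspension θ lifts through M ⟶ ΣX₀; this gives an idempotent of
  -- M.
  obtain ⟨b, hb⟩ := (hΘ.weakExact hA (n + 1)).lift θ (by
    rw [← cancel_mono i₁.hom, Category.assoc]
    change θ ≫ A.unrollMap (n + 2) ≫ i₁.hom = 0 ≫ i₁.hom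
    simp only [hi, θ, Category.assoc, Iso.inv_hom_id_assoc]
    rw [← T.map_comp, hηm, T.map_zero, comp_zero, zero_comp])
  have hθ' {P : C} (f : A.unrollObj (n + 2) ⟶ P) : θ ≫ θ ≫ f = θ ≫ f := by
    rw [← Category.assoc, hθ]
  have hb' {P : C} (f : A.unrollObj (n + 2) ⟶ P) : b ≫ A.unrollMap (n + 1) ≫ f = θ ≫ f := by
    rw [← Category.assoc]
    exact congrArg (· ≫ f) hb
  rcases idempotent_eq_zero_or_eq_id hM (e.inv ≫ (A.unrollMap (n + 1) ≫ θ ≫ b) ≫ e.hom) (by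
    simp only [Category.assoc, Iso.hom_inv_id_assoc, hb', hθ']) with h | h
  · have hp : A.unrollMap (n + 1) ≫ θ ≫ b = 0 := by
      rw [← cancel_epi e.inv, ← cancel_mono e.hom, Category.assoc, h]; simp
    have hθ0 : θ = 0 := by
      calc θ = θ ≫ θ ≫ θ := by rw [hθ, hθ]
        _ = b ≫ (A.unrollMap (n + 1) ≫ θ ≫ b) ≫ A.unrollMap (n + 1) := by
          simp only [Category.assoc, hb']
          exact congrArg (θ ≫ θ ≫ ·) hb.symm
        _ = 0 := by rw [hp, zero_comp, comp_zero]
    have hη0 : η = 0 := by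
      apply T.map_injective
      rw [T.map_zero, ← cancel_epi i₀.hom, ← cancel_mono i₀.inv, Category.assoc]
      exact hθ0.trans (by simp)
    have hπs : π ≫ s = 𝟙 _ := by
      rw [← hε, ← sub_eq_zero.1 (hη'.trans hη0), CategoryTheory.Functor.map_id]
    have : Mono π := mono_of_mono_fac hπs
    rw [← hπ]
    exact mono_comp _ _
  -- If that idempotent is the identity, M is a retract of ΣX₀.
  · refine absurd ?_ hMX
    have hr : InAdd (T.obj X) (A.unrollObj (n + 2)) := (hAX.map T).of_iso i₀.symm
    refine hr.of_retract (e.inv ≫ A.unrollMap (n + 1)) (θ ≫ b ≫ e.hom) ?_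
    rw [← h]
    simp

/-- Descending induction on `k`: the image at `k = n` is HM, and the image at `k` is a syzygy of the
one at `k + 1`. -/
theorem projectiveDimension_image_iff (hΘ : IsAngulated n T Θ) (hX : IsClusterTilting Θ X)
    {A : SigmaSeq n T} (hA : A ∈ Θ) (hAX : ∀ k ≤ n, InAdd X (A.unrollObj k)) (j k : ℕ)
    (hjk : k + j = n) :
    projectiveDimension (image ((preadditiveCoyonedaObj X).map (A.unrollMap k))) ≠ ⊤ ↔
      projectiveDimension ((preadditiveCoyonedaObj X).obj (A.unrollObj (n + 1))) ≠ ⊤ := by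
  have := hΘ.isEquivalence
  have := additive_of_isEquivalence T
  induction j generalizing k with
  | zero =>
    obtain rfl : k = n := by omega
    obtain ⟨i₀, -⟩ := A.exists_unrollMap_shift_iso
    have hepi := hX.coyonedaObj_map_epi (hAX 0 (by omega))
      ((hΘ.weakExact hA k).of_iso (Iso.refl _) (Iso.refl _) i₀
        (f' := A.unrollMap k) (g' := A.unrollMap (k + 1) ≫ i₀.hom) (by simp) (by simp))
    have : Epi (image.ι ((preadditiveCoyonedaObj X).map (A.unrollMap k))) :=
      epi_of_epi_fac (image.fac _)
    have : IsIso (image.ι ((preadditiveCoyonedaObj X).map (A.unrollMap k))) :=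
      isIso_of_mono_of_epi _
    rw [projectiveDimension_eq_of_iso
      (asIso (image.ι ((preadditiveCoyonedaObj X).map (A.unrollMap k))))]
  | succ j ih =>
    refine Iff.trans ?_ (ih (k + 1) (by omega))
    rw [projectiveDimension_ne_top_iff, projectiveDimension_ne_top_iff]
    have hS := shortExact_image ((hΘ.weakExact hA k).coyonedaObj_exact (X := X))
    have hP := (hAX (k + 1) (by omega)).coyonedaObj_projective
    constructor
    · rintro ⟨d, hd⟩
      exact ⟨d + 1, (hS.hasProjectiveDimensionLT_X₃_iff d hP).2 hd⟩
    -- The bound is weakened by one so that `d = 0` is covered as well.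
    · rintro ⟨d, hd⟩
      exact ⟨d, (hS.hasProjectiveDimensionLT_X₃_iff d hP).1
        (hasProjectiveDimensionLT_of_ge _ (d + 1) (d + 2) (by omega))⟩

/-- Each step down from `k = n` lowers the vanishing bound by one; at `k = 0` all positive degrees
vanish. -/
theorem extVanish_image_unroll (hΘ : IsAngulated n T Θ) (hn : 1 ≤ n) (hX : IsClusterTilting Θ X)
    {A : SigmaSeq n T} (hA : A ∈ Θ) (hAX : ∀ k ≤ n, InAdd X (A.unrollObj k)) {Z : C}
    (hZ : InAdd X Z) (j k : ℕ) (hjk : k + j = n) :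
    ExtVanish (image ((preadditiveCoyonedaObj X).map (A.unrollMap k)))
      ((preadditiveCoyonedaObj X).obj Z) k := by
  induction j generalizing k with
  | zero =>
    obtain rfl : k = n := by omega
    exact (isSyzygy_image _).extVanish_add hΘ hn hX hZ
  | succ j ih =>
    have hS := shortExact_image ((hΘ.weakExact hA k).coyonedaObj_exact (X := X))
    exact ExtVanish.X₁_of_X₃ hS (hAX (k + 1) (by omega)).coyonedaObj_projective
      (ih (k + 1) (by omega))

end HigherAngulated

open HigherAngulated
theorem theorem3p1 {C : Type u} [Category.{v} C] [Preadditive C] [HasFiniteBiproducts C]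
    [IsIdempotentComplete C] (n : ℕ) (hn : 1 ≤ n) (T : C ⥤ C) (Θ : Set (SigmaSeq n T))
    (hΘ : IsAngulated n T Θ) (X : C) (hX : IsClusterTilting Θ X)
    (M : C) (hM : Indecomposable M) (hMX : ¬ InAdd (T.obj X) M) :
    projectiveDimension ((preadditiveCoyonedaObj X).obj M) = ⊤ ↔
      factorizationIdeal (T.obj X) M ≠ ⊥ := by
  obtain ⟨A, hA, ⟨e⟩, hAX⟩ := hX.exists_unroll M
  -- Both sides are negated: finite projective dimension, moved to the image at index 0, against
  -- injectivity of HX₀ ⟶ HX₁.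
  rw [← not_iff_not, not_not, factorizationIdeal_eq_bot_iff_mono hΘ hX hA hAX e,
    ← projectiveDimension_eq_of_iso ((preadditiveCoyonedaObj X).mapIso e), ← ne_eq,
    ← projectiveDimension_image_iff hΘ hX hA hAX n 0 (by omega)]
  constructor
  · intro h
    obtain ⟨d, hd⟩ := (projectiveDimension_ne_top_iff _).1 h
    exact mono_of_projective_image hΘ hA (hAX 0 (by omega)) e hM hMX
      ((isSyzygy_image _).projective_of_extVanish hΘ hn hX d hd
        fun Z hZ => extVanish_image_unroll hΘ hn hX hA hAX hZ n 0 (by omega))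
  · intro h
    have : Mono (factorThruImage ((preadditiveCoyonedaObj X).map (A.unrollMap 0))) :=
      mono_of_mono_fac (image.fac _)
    have : IsIso (factorThruImage ((preadditiveCoyonedaObj X).map (A.unrollMap 0))) :=
      isIso_of_mono_of_epi _
    have := (hAX 0 (by omega)).coyonedaObj_projective
    exact (projectiveDimension_ne_top_iff _).2 ⟨0, hasProjectiveDimensionLT_of_iso
      (asIso (factorThruImage ((preadditiveCoyonedaObj X).map (A.unrollMap 0)))) 1⟩
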